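/- Let $\mathbb F$ be a finite field and let $n,k,\delta$ be positive integers with $k<n$ and $(n-k)\nmid\delta$. Put $\nu=\lfloor\delta/(n-k)\rfloor+1$ and $L=\lfloor\delta/k\rfloor+\nu-1$, so that $L=\lfloor\delta/k\rfloor+\lfloor\delta/(n-k)\rfloor$. Let $H(z)=\sum_{i=0}^{\nu}H_iz^i$ with $H_i\in\mathbb F^{(n-k)\times n}$ be a row-reduced polynomial matrix (that is, the sum of its row degrees is minimal among all matrices $U(z)H(z)$ with $U(z)\in\mathrm{GL}_{n-k}(\mathbb F[z])$) whose row degrees sum to $\delta$. Put $H_i=0$ for $i>\nu$ and $i<0$. Suppose that: 1. all full-size minors that are not trivially zero of the truncated sliding matrix $H_L^c=(H_{i-l})_{0\le i,l\le L}\in\mathbb F^{(L+1)(n-k)\times(L+1)n}$ are nonzero, i.e. every minor on columns $1\le t_1<\dots<t_{(L+1)(n-k)}\le (L+1)n$ with $t_{s(n-k)}\le sn$ for $s=1,\dots,L$ is nonzero; 2. there are $r\in\mathbb N_0$ and a set $S\subseteq\{1,\dots,n-k\}$ with $|S|=\delta-(n-k)\lfloor\delta/(n-k)\rfloor$ such that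 the matrix $$\bar H=\begin{bmatrix}H_0\\ \vdots&\ddots\\ H_\nu&&H_0\\ &\ddots&\vdots\\ &&\tilde H_\nu\end{bmatrix}$$ has full row rank. Here $\bar H$ has $r+1$ block columns and $r+\nu+1$ block rows; the first $r+\nu$ block rows are $(H_{i-l})_{0\le l\le r}$, $0\le i<r+\nu$, and the last one is $(0\ \cdots\ 0\ \tilde H_\nu)$, where $\tilde H_\nu$ consists of the rows of $H_\nu$ with index in $S$. Then $H(z)$ is left prime (in every factorization $H(z)=M(z)B(z)$ with $M(z)\in\mathbb F[z]^{(n-k)\times(n-k)}$ and $B(z)\in\mathbb F[z]^{(n-k)\times n}$, the factor $M(z)$ is unimodular), and $H(z)$ is a parity-check matrix of an $(n,k,\delta)$ MDP convolutional code $\mathcal C$. This means: $\mathcal C=\{c\in\mathbb F[z]^n: H(z)c(z)^\top=0\}$ is a submodule of $\mathbb F[z]^n$ of rank $k$; the highest degree of the $k\times k$ minors of a matrix whose rows form a basis of $\mathcal C$ is $\delta$; and for all $j=0,\dots,L$ the column distance $d_j^c=\min\{\sum_{i=0}^{j}\mathrm{wt}(v_i): v=\sum_i v_iz^i\in\mathcal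 C,\ v_0\neq0\}$, where $\mathrm{wt}$ is the Hamming weight, equals $(n-k)(j+1)+1$. -/

import Mathlib

open scoped Polynomial

namespace ConvCode

noncomputable section

variable {F : Type*} [Field F] {m n k : ℕ}

/-- A polynomial matrix is left prime if the left (square) factor in each of its factorizations
is unimodular, i.e. invertible over `F[X]`. -/
def IsLeftPrime (A : Matrix (Fin m) (Fin n) F[X]) : Prop :=
  ∀ (M : Matrix (Fin m) (Fin m) F[X]) (B : Matrix (Fin m) (Fin n) F[X]), A = M * B → IsUnit M

/-- The largest degree among the entries of row `a`. -/
def rowDegree (A : Matrix (Fin m) (Fin n) F[X]) (a : Fin m) : ℕ :=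
  Finset.univ.sup fun b => (A a b).natDegree

/-- Row-reduced (minimal): the sum of the row degrees is the smallest possible among all matrices
`U * A` with `U` unimodular. -/
def IsRowReduced (A : Matrix (Fin m) (Fin n) F[X]) : Prop :=
  ∀ U : Matrix (Fin m) (Fin m) F[X], IsUnit U →
    ∑ a, rowDegree A a ≤ ∑ a, rowDegree (U * A) a

/-- The rows of `G` form a basis of the code. -/
def IsGeneratorMatrix (G : Matrix (Fin k) (Fin n) F[X]) (C : Submodule F[X] (Fin n → F[X])) :
    Prop :=
  LinearIndependent F[X] G.row ∧ Submodule.span F[X] (Set.range G.row) = C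

/-- The highest degree of the `k × k` minors of a `k × n` polynomial matrix. -/
def maxMinorDegree (G : Matrix (Fin k) (Fin n) F[X]) : ℕ :=
  Finset.univ.sup fun t : Fin k ↪o Fin n => (G.submatrix id t).det.natDegree

/-- `(n, k, δ)` convolutional codes: submodules of `F[X]^n` of rank `k` and degree `δ`, the degree
being the highest degree of the full-size minors of a generator matrix. (Two generator matrices
differ by a unimodular factor, so the choice of `G` does not matter.) -/
def IsConvolutionalCode (n k δ : ℕ) (C : Submodule F[X] (Fin n → F[X])) : Prop :=
  Module.finrank F[X] C = k ∧
    ∃ G : Matrix (Fin k) (Fin n) F[X], IsGeneratorMatrix G C ∧ maxMinorDegree G = δ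

def IsParityCheckMatrix (H : Matrix (Fin m) (Fin n) F[X]) (C : Submodule F[X] (Fin n → F[X])) :
    Prop :=
  ∀ c : Fin n → F[X], c ∈ C ↔ H.mulVec c = 0

open Classical in
/-- The Hamming weight of the truncation `v_0 + v_1 z + ⋯ + v_j z^j` of `v`. -/
def truncWeight (v : Fin n → F[X]) (j : ℕ) : ℕ :=
  ∑ i ∈ Finset.range (j + 1), hammingNorm fun b => (v b).coeff i

/-- The `j`-th column distance: the least weight of `v_0 + ⋯ + v_j z^j` over the codewords `v`
with `v_0 ≠ 0`. (It is `0` if there is no such codeword.) -/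
def columnDistance (C : Submodule F[X] (Fin n → F[X])) (j : ℕ) : ℕ :=
  sInf {w | ∃ v ∈ C, (fun b => (v b).coeff 0) ≠ 0 ∧ truncWeight v j = w}

/-- `(n, k, δ)` convolutional codes with maximum distance profile. -/
def IsMDP (n k δ : ℕ) (C : Submodule F[X] (Fin n → F[X])) : Prop :=
  IsConvolutionalCode n k δ C ∧
    ∀ j ≤ δ / k + δ / (n - k), columnDistance C j = (n - k) * (j + 1) + 1

/-- The truncated sliding parity-check matrix `H_j^c`: its block in block row `i` and block column
`l` is the coefficient `H_{i-l}` if `l ≤ i`, and `0` otherwise. Row `p` is row `p % m` of block row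
`p / m`, and column `q` is column `q % n` of block column `q / n`. -/
def slidingMatrix (H : Matrix (Fin m) (Fin n) F[X]) (j : ℕ) :
    Matrix (Fin ((j + 1) * m)) (Fin ((j + 1) * n)) F :=
  Matrix.of fun p q =>
    if q.divNat ≤ p.divNat then
      (H p.modNat q.modNat).coeff ((p.divNat : ℕ) - (q.divNat : ℕ))
    else 0

/-- All full-size minors of `H_j^c` that are not trivially zero are nonzero. In one-based
numbering, the minor on the columns `t_1 < ⋯ < t_{(j+1)m}` is not trivially zero if
`t_{sm} ≤ sn` for `s = 1, …, j`, i.e. if for each `s` at least `sm` of its columns meet the first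
`s` block rows, which are supported on the first `sn` columns. Below, rows and columns are numbered
from zero, so `t_{sm} ≤ sn` reads `t i < s * n` at the index `i` with `i + 1 = s * m`. -/
def MDPMinorCriterion (H : Matrix (Fin m) (Fin n) F[X]) (j : ℕ) : Prop :=
  ∀ t : Fin ((j + 1) * m) ↪o Fin ((j + 1) * n),
    (∀ (s : ℕ) (i : Fin ((j + 1) * m)), 1 ≤ s → s ≤ j → (i : ℕ) + 1 = s * m →
      (t i : ℕ) < s * n) →
    ((slidingMatrix H j).submatrix id t).det ≠ 0

/-- The matrix `H̄` for a matrix `H = H_0 + ⋯ + H_ν z^ν`: it has `r + 1` block columns and `r + ν`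
complete block rows, the block in position `(i, l)` being `H_{i-l}` if `l ≤ i` and `0` otherwise,
followed by the last block row `(0 ⋯ 0 H̃_ν)`, in which `H̃_ν` consists of the rows of `H_ν`
with index in `S`. -/
def barMatrix (H : Matrix (Fin m) (Fin n) F[X]) (ν r : ℕ) (S : Finset (Fin m)) :
    Matrix ((Fin (r + ν) × Fin m) ⊕ S) (Fin (r + 1) × Fin n) F :=
  Matrix.of fun p q =>
    match p with
    | Sum.inl (i, a) =>
        if (q.1 : ℕ) ≤ (i : ℕ) then (H a q.2).coeff ((i : ℕ) - (q.1 : ℕ)) else 0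
    | Sum.inr a => if (q.1 : ℕ) = r then (H a q.2).coeff ν else 0

end

end ConvCode

/-!
Full row rank of `H̄` means that every `y` with `deg y_a ≤ r + rowDegree H a` is of the form `H x`
with `deg x ≤ r`. Taking `y = e_a` shows that `H` is surjective, hence left prime, and that its
kernel has rank `k`. Taking `y = z ^ (r + rowDegree H a) e_a` shows that the leading row coefficient
matrix is surjective, so that some full-size minor of `H` has degree `∑ rowDegree H a = δ`. By
Jacobi's identity, complementary full-size minors of `H` and of a generator matrix of its kernel
agree up to a unit, so the code has degree `δ`.

Consider a codeword with `v_0 ≠ 0` and the first `j` at which its truncation is too light. Since the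
earlier truncations are heavy enough, the columns of `H_j^c` on its support can be completed to
those of a minor that is not trivially zero; they are therefore independent, a contradiction.
Conversely, the first `n - k` columns of `H` form a matrix that is invertible modulo `z ^ (j + 1)`.
This yields a vector supported on `n - k + 1` coordinates, one of them constant, that `H` kills
modulo `z ^ (j + 1)`, and surjectivity of `H` lifts it to a codeword.
-/

namespace ConvCode

open Matrix Polynomial

section LinearAlgebra

variable {R ι κ η : Type*} [CommRing R]

theorem mulVec_surjective_of_forall_single [Finite ι] [DecidableEq ι] [Fintype η]
    {A : Matrix ι η R} (h : ∀ i, ∃ x, A *ᵥ x = Pi.single i 1) : Function.Surjective A.mulVec := by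
  choose x hx using h
  refine mulVec_surjective_iff_exists_right_inverse.2 ⟨(Matrix.of x)ᵀ, ?_⟩
  ext i j
  rw [one_eq_pi_single, Pi.single_comm, ← hx j]
  rfl

theorem mulVec_surjective_of_linearIndependent_row {K : Type*} [Field K] [Finite ι] [Fintype η]
    {A : Matrix ι η K} (h : LinearIndependent K A.row) : Function.Surjective A.mulVec := by
  have := Fintype.ofFinite ι
  refine LinearMap.range_eq_top.1 (Submodule.eq_top_of_finrank_eq (S := A.mulVecLin.range) ?_)
  rw [Module.finrank_pi]
  exact h.rank_matrix

theorem exists_orderEmbedding_det_submatrix_ne_zero {K : Type*} [Field K] [Fintype η]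
    [LinearOrder η] {m : ℕ} {A : Matrix (Fin m) η K} (hA : Function.Surjective A.mulVec) :
    ∃ t : Fin m ↪o η, (A.submatrix id t).det ≠ 0 := by
  classical
  obtain ⟨b, -, -, hspan, hb⟩ := exists_linearIndepOn_extension
    (linearIndepOn_empty K A.col) (Set.empty_subset Set.univ)
  have hcard : b.toFinset.card = m := by
    have htop : Submodule.span K (A.col '' b) = ⊤ := by
      refine top_le_iff.1 ((LinearMap.range_eq_top (f := A.mulVecLin).2 hA).ge.trans ?_)
      rw [range_mulVecLin, ← Set.image_univ]
      exact Submodule.span_le.2 hspan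
    have := finrank_span_eq_card hb
    rw [Set.range_comp', Subtype.range_coe] at this
    rw [htop] at this
    simpa using this.symm
  let t := b.toFinset.orderEmbOfFin hcard
  have ht (i : Fin m) : t i ∈ b := Set.mem_toFinset.1 (Finset.orderEmbOfFin_mem _ hcard i)
  refine ⟨t, ((isUnit_iff_isUnit_det _).1 (linearIndependent_cols_iff_isUnit.1 ?_)).ne_zero⟩
  exact hb.comp (fun i => ⟨t i, ht i⟩) fun i j hij => t.injective (Subtype.mk.inj hij)

theorem submatrix_mulVec_comp {f : κ → η} [Fintype κ] [Fintype η] (hf : Function.Injective f)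
    (A : Matrix ι η R) {u : η → R} (hu : ∀ q ∉ Set.range f, u q = 0) :
    A.submatrix id f *ᵥ (u ∘ f) = A *ᵥ u := by
  ext i
  exact Fintype.sum_of_injective f hf _ _ (fun q hq => by rw [hu q hq, mul_zero]) fun _ => rfl

theorem submatrix_inl_mul_add_submatrix_inr_mul {μ l : Type*} [Fintype ι] [Fintype κ] [Fintype η]
    (e : ι ⊕ κ ≃ η) (A : Matrix μ η R) (B : Matrix η l R) :
    A.submatrix id (e ∘ Sum.inl) * B.submatrix (e ∘ Sum.inl) id +
      A.submatrix id (e ∘ Sum.inr) * B.submatrix (e ∘ Sum.inr) id = A * B := by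
  ext i j
  simp only [Matrix.add_apply, mul_apply, submatrix_apply, id, Function.comp_apply]
  rw [← e.sum_comp, Fintype.sum_sum_type]

theorem associated_det_complementary [Fintype ι] [Fintype κ] [Finite η] [DecidableEq ι]
    [DecidableEq κ] [DecidableEq η] {H : Matrix ι η R} {X : Matrix η ι R} {G Y : Matrix κ η R}
    (hone : X * H + Gᵀ * Y = 1) (e : ι ⊕ κ ≃ η) :
    Associated (H.submatrix id (e ∘ Sum.inl)).det (G.submatrix id (e ∘ Sum.inr)).det := by
  have := Fintype.ofFinite η
  have hinv : fromCols X Gᵀ * fromRows H Y = 1 := by rw [fromCols_mul_fromRows, hone]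
  obtain ⟨hHX, hHG, -, -⟩ : H * X = 1 ∧ H * Gᵀ = 0 ∧ Y * X = 0 ∧ Y * Gᵀ = 1 := by
    rw [← fromBlocks_inj, ← fromRows_mul_fromCols, fromBlocks_one]
    exact (mul_eq_one_comm_of_equiv e.symm).1 hinv
  set V := (fromCols X Gᵀ).submatrix e id with hV
  have hVblocks : V = fromBlocks (X.submatrix (e ∘ Sum.inl) id) (G.submatrix id (e ∘ Sum.inl))ᵀ
      (X.submatrix (e ∘ Sum.inr) id) (G.submatrix id (e ∘ Sum.inr))ᵀ := by
    ext (i | i) (j | j) <;> rfl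
  have hVunit : IsUnit V.det := by
    refine (isUnit_iff_isUnit_det _).1
      (IsUnit.of_mul_eq_one ((fromRows H Y).submatrix id e) ?_)
    rw [hV, ← submatrix_mul _ _ e id e Function.bijective_id, hinv, submatrix_one_equiv]
  have hprod : fromBlocks (H.submatrix id (e ∘ Sum.inl)) (H.submatrix id (e ∘ Sum.inr)) 0 1 * V =
      fromBlocks 1 0 (X.submatrix (e ∘ Sum.inr) id) (G.submatrix id (e ∘ Sum.inr))ᵀ := by
    rw [hVblocks, fromBlocks_multiply, transpose_submatrix, transpose_submatrix,
      submatrix_inl_mul_add_submatrix_inr_mul, submatrix_inl_mul_add_submatrix_inr_mul, hHX, hHG]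
    simp only [Matrix.zero_mul, Matrix.one_mul, zero_add]
  have hdet := congrArg det hprod
  rw [det_mul, det_fromBlocks_zero₂₁, det_fromBlocks_zero₁₂, det_one, det_one, mul_one, one_mul,
    det_transpose] at hdet
  exact ⟨hVunit.unit, hdet⟩

theorem exists_complementary_orderEmbedding [Fintype η] [LinearOrder η] {m k : ℕ}
    (hmk : m + k = Fintype.card η) (t : Fin m ↪o η) :
    ∃ (t' : Fin k ↪o η) (e : Fin m ⊕ Fin k ≃ η), e ∘ Sum.inl = t ∧ e ∘ Sum.inr = t' := by
  have hs : (Finset.univ.map t.toEmbedding).card = m := by simp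
  have hs' : (Finset.univ.map t.toEmbedding)ᶜ.card = k := by
    rw [Finset.card_compl, hs]
    omega
  refine ⟨(Finset.univ.map t.toEmbedding)ᶜ.orderEmbOfFin hs', finSumEquivOfFinset hs hs', ?_, rfl⟩
  have ht : t = Finset.orderEmbOfFin _ hs := Finset.orderEmbOfFin_unique' hs fun i => by simp
  exact (congrArg DFunLike.coe ht).symm

theorem coeff_prod_sum_of_natDegree_le (s : Finset ι) (f : ι → R[X]) (d : ι → ℕ)
    (h : ∀ i ∈ s, (f i).natDegree ≤ d i) :
    (∏ i ∈ s, f i).coeff (∑ i ∈ s, d i) = ∏ i ∈ s, (f i).coeff (d i) := by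
  classical
  induction s using Finset.induction_on with
  | empty => simp
  | insert a s ha ih =>
    obtain ⟨hfa, hfs⟩ := (Finset.forall_mem_insert _ _ _).1 h
    have hdeg : (∏ i ∈ s, f i).natDegree ≤ ∑ i ∈ s, d i :=
      (natDegree_prod_le _ _).trans (Finset.sum_le_sum hfs)
    rw [Finset.prod_insert ha, Finset.prod_insert ha, Finset.sum_insert ha,
      coeff_mul_add_eq_of_natDegree_le hfa hdeg, ih hfs]

variable [Fintype ι] [DecidableEq ι] {M : Matrix ι ι R[X]} {d : ι → ℕ}

theorem natDegree_det_le_sum (h : ∀ a b, (M a b).natDegree ≤ d a) :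
    M.det.natDegree ≤ ∑ a, d a := by
  rw [det_apply]
  refine natDegree_sum_le_of_forall_le _ _ fun σ _ => (natDegree_smul_le _ _).trans ?_
  rw [← Equiv.sum_comp σ d]
  exact (natDegree_prod_le _ _).trans (Finset.sum_le_sum fun i _ => h _ _)

theorem coeff_det_sum (h : ∀ a b, (M a b).natDegree ≤ d a) :
    M.det.coeff (∑ a, d a) = (Matrix.of fun a b => (M a b).coeff (d a)).det := by
  rw [det_apply, det_apply, finsetSum_coeff]
  refine Finset.sum_congr rfl fun σ _ => ?_
  rw [coeff_smul, ← Equiv.sum_comp σ d, coeff_prod_sum_of_natDegree_le _ _ _ fun i _ => h _ _]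
  rfl

end LinearAlgebra

section Dual

variable {F : Type*} [Field F] {m n k : ℕ} {H : Matrix (Fin m) (Fin n) F[X]}

theorem isLeftPrime_of_mulVec_surjective (hH : Function.Surjective H.mulVec) : IsLeftPrime H := by
  rintro M B rfl
  refine mulVec_surjective_iff_isUnit.1 (Function.Surjective.of_comp (g := B.mulVec) ?_)
  simpa only [Function.comp_def, mulVec_mulVec] using hH

theorem finrank_ker_mulVecLin (hH : Function.Surjective H.mulVec) (hmk : m + k = n) :
    Module.finrank F[X] (LinearMap.ker H.mulVecLin) = k := by
  have hrank := (LinearMap.ker H.mulVecLin).finrank_quotient_add_finrank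
  rw [(H.mulVecLin.quotKerEquivOfSurjective hH).finrank_eq, Module.finrank_fin_fun,
    Module.finrank_fin_fun] at hrank
  omega

theorem exists_isGeneratorMatrix {C : Submodule F[X] (Fin n → F[X])}
    (hC : Module.finrank F[X] C = k) :
    ∃ G : Matrix (Fin k) (Fin n) F[X], IsGeneratorMatrix G C := by
  let b := Module.finBasisOfFinrankEq F[X] C hC
  refine ⟨Matrix.of fun i => (b i : Fin n → F[X]), ?_, ?_⟩
  · exact b.linearIndependent.map' C.subtype C.ker_subtype
  · have hspan := congrArg (Submodule.map C.subtype) b.span_eq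
    rwa [Submodule.map_span, ← Set.range_comp, Submodule.map_top, Submodule.range_subtype] at hspan

theorem IsGeneratorMatrix.exists_mul_add_transpose_mul_eq_one {G : Matrix (Fin k) (Fin n) F[X]}
    (hG : IsGeneratorMatrix G (LinearMap.ker H.mulVecLin)) (hH : Function.Surjective H.mulVec) :
    ∃ (X : Matrix (Fin n) (Fin m) F[X]) (Y : Matrix (Fin k) (Fin n) F[X]),
      X * H + Gᵀ * Y = 1 := by
  obtain ⟨X, hHX⟩ := mulVec_surjective_iff_exists_right_inverse.1 hH
  have hmem (j : Fin n) : (1 - X * H).col j ∈ Submodule.span F[X] (Set.range G.row) := by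
    have hzero : H * (1 - X * H) = 0 := by
      rw [Matrix.mul_sub, ← Matrix.mul_assoc, hHX, Matrix.mul_one, Matrix.one_mul, sub_self]
    rw [hG.2, LinearMap.mem_ker, mulVecLin_apply]
    ext1 a
    exact congrFun (congrFun hzero a) j
  choose y hy using fun j => (Submodule.mem_span_range_iff_exists_fun _).1 (hmem j)
  refine ⟨X, (Matrix.of y)ᵀ, ?_⟩
  rw [← eq_sub_iff_add_eq']
  ext1 i j
  have hyij := congrFun (hy j) i
  simp only [Finset.sum_apply, Pi.smul_apply, smul_eq_mul, col_apply, row_apply] at hyij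
  rw [← hyij, mul_apply]
  exact Finset.sum_congr rfl fun l _ => mul_comm _ _

theorem natDegree_le_maxMinorDegree (t : Fin m ↪o Fin n) :
    (H.submatrix id t).det.natDegree ≤ maxMinorDegree H :=
  Finset.le_sup (f := fun t : Fin m ↪o Fin n => (H.submatrix id t).det.natDegree)
    (Finset.mem_univ t)

theorem IsGeneratorMatrix.maxMinorDegree_eq {G : Matrix (Fin k) (Fin n) F[X]}
    (hG : IsGeneratorMatrix G (LinearMap.ker H.mulVecLin)) (hH : Function.Surjective H.mulVec)
    (hmk : m + k = n) : maxMinorDegree G = maxMinorDegree H := by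
  obtain ⟨X, Y, hone⟩ := hG.exists_mul_add_transpose_mul_eq_one hH
  have hdeg (e : Fin m ⊕ Fin k ≃ Fin n) : (H.submatrix id (e ∘ Sum.inl)).det.natDegree =
      (G.submatrix id (e ∘ Sum.inr)).det.natDegree :=
    natDegree_eq_of_degree_eq (degree_eq_degree_of_associated (associated_det_complementary hone e))
  apply le_antisymm
  · refine Finset.sup_le fun t _ => ?_
    obtain ⟨t', e, het, het'⟩ := exists_complementary_orderEmbedding (k := m) (by simp; omega) t
    rw [← het, show e ∘ Sum.inl = (Equiv.sumComm _ _).trans e ∘ Sum.inr from rfl, ← hdeg]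
    exact het' ▸ natDegree_le_maxMinorDegree t'
  · refine Finset.sup_le fun t _ => ?_
    obtain ⟨t', e, het, het'⟩ := exists_complementary_orderEmbedding (k := k) (by simp [hmk]) t
    rw [← het, hdeg]
    exact het' ▸ natDegree_le_maxMinorDegree t'

theorem natDegree_le_rowDegree (H : Matrix (Fin m) (Fin n) F[X]) (a : Fin m) (b : Fin n) :
    (H a b).natDegree ≤ rowDegree H a :=
  Finset.le_sup (f := fun b => (H a b).natDegree) (Finset.mem_univ b)

/-- The leading row coefficient matrix of `H`: row `a` holds the coefficients of degree
`rowDegree H a` of row `a` of `H`. -/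
def leadingRowCoeff (H : Matrix (Fin m) (Fin n) F[X]) : Matrix (Fin m) (Fin n) F :=
  Matrix.of fun a b => (H a b).coeff (rowDegree H a)

theorem maxMinorDegree_eq_sum_rowDegree (hlead : Function.Surjective (leadingRowCoeff H).mulVec) :
    maxMinorDegree H = ∑ a, rowDegree H a := by
  apply le_antisymm
  · exact Finset.sup_le fun t _ => natDegree_det_le_sum fun a b => natDegree_le_rowDegree H a (t b)
  · obtain ⟨t, ht⟩ := exists_orderEmbedding_det_submatrix_ne_zero hlead
    refine (le_natDegree_of_ne_zero ?_).trans (natDegree_le_maxMinorDegree t)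
    rwa [coeff_det_sum (M := H.submatrix id t) fun a b => natDegree_le_rowDegree H a (t b)]

theorem isConvolutionalCode_ker_mulVecLin (hH : Function.Surjective H.mulVec) (hmk : m + k = n) :
    IsConvolutionalCode n k (maxMinorDegree H) (LinearMap.ker H.mulVecLin) := by
  have hrank := finrank_ker_mulVecLin hH hmk
  obtain ⟨G, hG⟩ := exists_isGeneratorMatrix hrank
  exact ⟨hrank, G, hG, hG.maxMinorDegree_eq hH hmk⟩

end Dual

section BarMatrix

variable {F : Type*} [Field F] {m n : ℕ} {H : Matrix (Fin m) (Fin n) F[X]}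

theorem coeff_mulVec_eq_sum {N i : ℕ} {x : Fin n → F[X]}
    (hx : ∀ b l, N ≤ l → l ≤ i → (x b).coeff l = 0) (a : Fin m) :
    ((H *ᵥ x) a).coeff i = ∑ q : Fin N × Fin n,
      (if (q.1 : ℕ) ≤ i then (H a q.2).coeff (i - q.1) else 0) * (x q.2).coeff q.1 := by
  rw [mulVec, dotProduct, finsetSum_coeff, Fintype.sum_prod_type_right]
  refine Finset.sum_congr rfl fun b _ => ?_
  rw [mul_comm, coeff_mul, Finset.Nat.sum_antidiagonal_eq_sum_range_succ_mk,
    Fin.sum_univ_eq_sum_range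
      (fun l => (if l ≤ i then (H a b).coeff (i - l) else 0) * (x b).coeff l) N]
  refine Finset.sum_congr_of_eq_on_inter (fun l hl hl' => ?_) (fun l _ hl' => ?_)
    (fun l hl _ => ?_)
  · rw [hx b l (by simpa using hl') (Nat.lt_succ_iff.1 (Finset.mem_range.1 hl)), zero_mul]
  · rw [if_neg (by simpa using hl'), zero_mul]
  · rw [if_pos (Nat.lt_succ_iff.1 (Finset.mem_range.1 hl)), mul_comm]

theorem natDegree_mulVec_le {r : ℕ} {x : Fin n → F[X]} (hx : ∀ b, (x b).natDegree ≤ r)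
    (a : Fin m) : ((H *ᵥ x) a).natDegree ≤ rowDegree H a + r :=
  natDegree_sum_le_of_forall_le Finset.univ (fun b => H a b * x b) fun b _ =>
    natDegree_mul_le_of_le (natDegree_le_rowDegree H a b) (hx b)

theorem leadingRowCoeff_mulVec_coeff {r : ℕ} {x : Fin n → F[X]} (hx : ∀ b, (x b).natDegree ≤ r) :
    (leadingRowCoeff H *ᵥ fun b => (x b).coeff r) =
      fun a => ((H *ᵥ x) a).coeff (rowDegree H a + r) := by
  ext a
  rw [mulVec, dotProduct, mulVec, dotProduct, finsetSum_coeff]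
  exact Finset.sum_congr rfl fun b _ =>
    (coeff_mul_add_eq_of_natDegree_le (natDegree_le_rowDegree H a b) (hx b)).symm

theorem le_rowDegree_of_coeff_ne_zero {a : Fin m} {b : Fin n} {d : ℕ} (h : (H a b).coeff d ≠ 0) :
    d ≤ rowDegree H a :=
  (le_natDegree_of_ne_zero h).trans (natDegree_le_rowDegree H a b)

variable {μ r : ℕ} {S : Finset (Fin m)}

theorem add_ite_le_rowDegree (hbar : LinearIndependent F (barMatrix H (μ + 1) r S).row)
    (a : Fin m) : (μ + if a ∈ S then 1 else 0) ≤ rowDegree H a := by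
  split_ifs with ha
  · obtain ⟨⟨l, b⟩, hlb⟩ := Function.ne_iff.1 (hbar.ne_zero (Sum.inr ⟨a, ha⟩))
    refine le_rowDegree_of_coeff_ne_zero (b := b) fun hcoeff => hlb ?_
    simp [barMatrix, hcoeff]
  · obtain ⟨⟨l, b⟩, hlb⟩ := Function.ne_iff.1 (hbar.ne_zero (Sum.inl (Fin.last (r + μ), a)))
    have hl : (l : ℕ) ≤ r := Nat.lt_succ_iff.1 l.2
    have hcoeff : (H a b).coeff (r + μ - l) ≠ 0 := by
      simpa [barMatrix, show (l : ℕ) ≤ r + μ by omega] using hlb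
    have := le_rowDegree_of_coeff_ne_zero hcoeff
    omega

theorem rowDegree_eq_add_ite (hbar : LinearIndependent F (barMatrix H (μ + 1) r S).row)
    (hsum : ∑ a, rowDegree H a = m * μ + S.card) (a : Fin m) :
    rowDegree H a = μ + if a ∈ S then 1 else 0 := by
  have hsum' : ∑ a, (μ + if a ∈ S then 1 else 0) = ∑ a, rowDegree H a := by
    simp [hsum, Finset.sum_add_distrib]
  exact ((Finset.sum_eq_sum_iff_of_le fun a _ => add_ite_le_rowDegree hbar a).1 hsum' a
    (Finset.mem_univ a)).symm

theorem exists_mulVec_eq_of_linearIndependent_barMatrix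
    (hbar : LinearIndependent F (barMatrix H (μ + 1) r S).row)
    (hrow : ∀ a, rowDegree H a ≤ μ + if a ∈ S then 1 else 0) {y : Fin m → F[X]}
    (hy : ∀ a, (y a).natDegree ≤ rowDegree H a + r) :
    ∃ x : Fin n → F[X], (∀ b, (x b).natDegree ≤ r) ∧ H *ᵥ x = y := by
  classical
  obtain ⟨u, hu⟩ := mulVec_surjective_of_linearIndependent_row hbar
    (Sum.elim (fun p => (y p.2).coeff p.1) fun a => (y a).coeff (r + (μ + 1)))
  let x (b : Fin n) : F[X] := Polynomial.ofFn (r + 1) fun l => u (l, b)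
  have hxdeg (b : Fin n) : (x b).natDegree ≤ r :=
    Nat.lt_succ_iff.1 (ofFn_natDegree_lt (Nat.succ_pos r) _)
  have hxcoeff (q : Fin (r + 1) × Fin n) : (x q.2).coeff q.1 = u q :=
    ofFn_coeff_eq_val_of_lt _ q.1.2
  have hHx (a : Fin m) (i : ℕ) : ((H *ᵥ x) a).coeff i = ∑ q : Fin (r + 1) × Fin n,
      (if (q.1 : ℕ) ≤ i then (H a q.2).coeff (i - q.1) else 0) * u q := by
    simp only [← hxcoeff]
    exact coeff_mulVec_eq_sum (fun b l hl _ => ofFn_coeff_eq_zero_of_ge _ hl) a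
  refine ⟨x, hxdeg, funext fun a => Polynomial.ext fun i => ?_⟩
  rcases lt_or_ge i (r + (μ + 1)) with hi | hi
  · exact (hHx a i).trans (congrFun hu (Sum.inl (⟨i, hi⟩, a)))
  by_cases hia : a ∈ S ∧ i = r + (μ + 1)
  · obtain ⟨ha, rfl⟩ := hia
    rw [hHx]
    refine Eq.trans (Finset.sum_congr rfl fun q _ => ?_) (congrFun hu (Sum.inr ⟨a, ha⟩))
    obtain hq | hq : (q.1 : ℕ) = r ∨ (q.1 : ℕ) < r := by omega
    · simp [barMatrix, hq]
    · have hcoeff : (H a q.2).coeff (r + (μ + 1) - q.1) = 0 := by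
        refine coeff_eq_zero_of_natDegree_lt ((natDegree_le_rowDegree H a q.2).trans_lt ?_)
        have hrow_a := hrow a
        rw [if_pos ha] at hrow_a
        omega
      simp [barMatrix, hcoeff, hq.ne]
  · have hlt : rowDegree H a + r < i := by
      have hrow_a := hrow a
      split_ifs at hrow_a with ha
      · have hi_ne : i ≠ r + (μ + 1) := fun h => hia ⟨ha, h⟩
        omega
      · omega
    rw [coeff_eq_zero_of_natDegree_lt ((natDegree_mulVec_le hxdeg a).trans_lt hlt),
      coeff_eq_zero_of_natDegree_lt ((hy a).trans_lt hlt)]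

theorem mulVec_surjective_of_linearIndependent_barMatrix
    (hbar : LinearIndependent F (barMatrix H (μ + 1) r S).row)
    (hrow : ∀ a, rowDegree H a ≤ μ + if a ∈ S then 1 else 0) : Function.Surjective H.mulVec := by
  refine mulVec_surjective_of_forall_single fun a => ?_
  have hdeg (c : Fin m) : ((Pi.single a 1 : Fin m → F[X]) c).natDegree ≤ rowDegree H c + r := by
    rw [Pi.single_apply]
    split_ifs <;> simp
  obtain ⟨x, -, hx⟩ := exists_mulVec_eq_of_linearIndependent_barMatrix hbar hrow hdeg
  exact ⟨x, hx⟩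

theorem leadingRowCoeff_mulVec_surjective
    (hbar : LinearIndependent F (barMatrix H (μ + 1) r S).row)
    (hrow : ∀ a, rowDegree H a ≤ μ + if a ∈ S then 1 else 0) :
    Function.Surjective (leadingRowCoeff H).mulVec := by
  refine mulVec_surjective_of_forall_single fun a => ?_
  have hdeg (c : Fin m) : ((Pi.single a (X ^ (rowDegree H a + r)) : Fin m → F[X]) c).natDegree ≤
      rowDegree H c + r := by
    obtain rfl | hca := eq_or_ne c a
    · simp
    · simp [hca]
  obtain ⟨x, hxdeg, hx⟩ := exists_mulVec_eq_of_linearIndependent_barMatrix hbar hrow hdeg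
  refine ⟨fun b => (x b).coeff r, ?_⟩
  rw [leadingRowCoeff_mulVec_coeff hxdeg, hx]
  ext c
  obtain rfl | hca := eq_or_ne c a
  · simp
  · simp [hca]

end BarMatrix

section SlidingMatrix

variable {F : Type*} [Field F] {m n : ℕ} {H : Matrix (Fin m) (Fin n) F[X]}

theorem divNat_finProdFinEquiv {N : ℕ} (p : Fin N × Fin n) : (finProdFinEquiv p).divNat = p.1 :=
  congrArg Prod.fst (finProdFinEquiv.symm_apply_apply p)

theorem modNat_finProdFinEquiv {N : ℕ} (p : Fin N × Fin n) : (finProdFinEquiv p).modNat = p.2 :=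
  congrArg Prod.snd (finProdFinEquiv.symm_apply_apply p)

theorem divNat_lt_iff {N s : ℕ} (q : Fin (N * n)) : (q.divNat : ℕ) < s ↔ (q : ℕ) < s * n :=
  Nat.div_lt_iff_lt_mul (Nat.pos_of_mul_pos_left (Nat.zero_lt_of_lt q.2))

theorem exists_orderEmbedding_extension {p q p' q' : ℕ} (t : Fin p ↪o Fin q) (hq : q ≤ q')
    (hpq : p' + q ≤ q' + p) :
    ∃ t' : Fin p' ↪o Fin q', (∀ (i : Fin p') (hi : i < p), (t' i : ℕ) = t ⟨i, hi⟩) ∧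
      ∀ i : Fin p', p ≤ i → (t' i : ℕ) = q + (i - p) := by
  let f (i : ℕ) : ℕ := if hi : i < p then t ⟨i, hi⟩ else q + (i - p)
  have hf_lt (i : ℕ) (hi : i < p) : f i = t ⟨i, hi⟩ := dif_pos hi
  have hf_ge (i : ℕ) (hi : p ≤ i) : f i = q + (i - p) := dif_neg hi.not_gt
  have hf_mono : StrictMono f := by
    intro i i' hii'
    rcases lt_or_ge i' p with hi' | hi'
    · rw [hf_lt i (hii'.trans hi'), hf_lt i' hi']
      exact t.strictMono hii'
    · rw [hf_ge i' hi']
      rcases lt_or_ge i p with hi | hi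
      · rw [hf_lt i hi]
        omega
      · rw [hf_ge i hi]
        omega
  have hf_bound (i : Fin p') : f i < q' := by
    rcases lt_or_ge (i : ℕ) p with hi | hi
    · rw [hf_lt i hi]
      omega
    · rw [hf_ge i hi]
      omega
  exact ⟨OrderEmbedding.ofStrictMono (fun i => ⟨f i, hf_bound i⟩) fun _ _ hii' => hf_mono hii',
    fun i hi => hf_lt i hi, fun i hi => hf_ge i hi⟩

theorem MDPMinorCriterion.of_succ {j : ℕ} (h : MDPMinorCriterion H (j + 1)) (hmn : m ≤ n) :
    MDPMinorCriterion H j := by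
  intro t ht
  have hm : (j + 1 + 1) * m = (j + 1) * m + m := Nat.succ_mul _ _
  have hn : (j + 1 + 1) * n = (j + 1) * n + n := Nat.succ_mul _ _
  have hm_le : (j + 1) * m ≤ (j + 1 + 1) * m := by omega
  have hn_le : (j + 1) * n ≤ (j + 1 + 1) * n := by omega
  obtain ⟨t', ht'_lt, ht'_ge⟩ :=
    exists_orderEmbedding_extension (p' := (j + 1 + 1) * m) t hn_le (by omega)
  have hdet := h t' fun s i hs hsj hi => by
    rcases hsj.lt_or_eq with hsj | rfl
    · have hsm : s * m ≤ (j + 1) * m := Nat.mul_le_mul_right m hsj.le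
      rw [ht'_lt i (by omega)]
      exact ht s _ hs (Nat.lt_succ_iff.1 hsj) hi
    · rw [ht'_lt i (by omega)]
      exact (t _).2
  have hzero (i : Fin ((j + 1 + 1) * m)) (hi : (i : ℕ) < (j + 1) * m)
      (i' : Fin ((j + 1 + 1) * m)) (hi' : ¬(i' : ℕ) < (j + 1) * m) :
      (slidingMatrix H (j + 1)).submatrix id t' i i' = 0 := by
    have hcol : ¬((t' i').divNat : ℕ) < j + 1 := by
      rw [divNat_lt_iff, ht'_ge i' (not_lt.1 hi')]
      omega
    have hrow : (i.divNat : ℕ) < j + 1 := (divNat_lt_iff i).2 hi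
    exact if_neg (not_le.2 (hrow.trans_le (not_lt.1 hcol)))
  rw [twoBlockTriangular_det' _ (fun i : Fin _ => (i : ℕ) < (j + 1) * m) hzero,
    ← det_submatrix_equiv_self (Fin.castLEquiv hm_le)] at hdet
  convert left_ne_zero_of_mul hdet using 2
  ext i i'
  have ht'i : t' (Fin.castLE hm_le i') = Fin.castLE hn_le (t i') := Fin.ext (ht'_lt _ i'.2)
  change _ = slidingMatrix H (j + 1) (Fin.castLE hm_le i) (t' (Fin.castLE hm_le i'))
  rw [ht'i]
  rfl

theorem MDPMinorCriterion.mono {j L : ℕ} (h : MDPMinorCriterion H L) (hmn : m ≤ n) (hj : j ≤ L) :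
    MDPMinorCriterion H j := by
  induction hj with
  | refl => exact h
  | step _ ih => exact ih (h.of_succ hmn)

theorem MDPMinorCriterion.det_coeff_zero_ne_zero (h : MDPMinorCriterion H 0)
    (t : Fin m ↪o Fin n) : (H.submatrix id t).det.coeff 0 ≠ 0 := by
  let em := Fin.castOrderIso (Nat.one_mul m).symm
  let en := Fin.castOrderIso (Nat.one_mul n).symm
  have hdet := h (em.symm.toOrderEmbedding.trans (t.trans en.toOrderEmbedding))
    fun s i hs hs0 => absurd (hs.trans hs0) (by simp)
  rw [← det_submatrix_equiv_self em.toEquiv] at hdet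
  rw [← constantCoeff_apply, RingHom.map_det]
  convert hdet using 2
  ext i b
  have hmod {l : ℕ} (p : Fin l) : (Fin.cast (Nat.one_mul l).symm p).modNat = p :=
    Fin.ext (Nat.mod_eq_of_lt p.2)
  simp [slidingMatrix, em, en, hmod]

theorem apply_orderEmbOfFin_of_lt_card_filter {α : Type*} [LinearOrder α] {P : α → Prop}
    [DecidablePred P] (hP : Antitone P) {T : Finset α} {c : ℕ} (hT : T.card = c) {i : Fin c}
    (hi : i < (T.filter P).card) : P (T.orderEmbOfFin hT i) := by
  by_contra hPi
  have hsub : T.filter P ⊆ (Finset.Iio i).map (T.orderEmbOfFin hT).toEmbedding := by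
    intro x hx
    obtain ⟨hxT, hPx⟩ := Finset.mem_filter.1 hx
    obtain ⟨l, rfl⟩ : x ∈ Set.range (T.orderEmbOfFin hT) := by rwa [Finset.range_orderEmbOfFin]
    refine Finset.mem_map_of_mem _ (Finset.mem_Iio.2 (lt_of_not_ge fun hil => hPi ?_))
    exact hP ((T.orderEmbOfFin hT).monotone hil) hPx
  have hcard := Finset.card_le_card hsub
  rw [Finset.card_map, Fin.card_Iio] at hcard
  omega

open Classical in
theorem MDPMinorCriterion.lt_hammingNorm {j : ℕ} (h : MDPMinorCriterion H j)
    {u : Fin ((j + 1) * n) → F} (hu : u ≠ 0) (hHu : slidingMatrix H j *ᵥ u = 0)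
    (hcount : ∀ s, 1 ≤ s → s ≤ j →
      s * m ≤ (Finset.univ.filter fun q => u q ≠ 0 ∧ (q : ℕ) < s * n).card) (hmn : m ≤ n) :
    (j + 1) * m < hammingNorm u := by
  by_contra! hle
  obtain ⟨T, hsupp, hT⟩ := Finset.exists_superset_card_eq hle
    (by simpa using Nat.mul_le_mul_left (j + 1) hmn)
  let t := T.orderEmbOfFin hT
  have hut (q) (hq : q ∉ Set.range t) : u q = 0 := by
    by_contra huq
    exact hq (by
      rw [Finset.range_orderEmbOfFin]
      exact hsupp (Finset.mem_filter.2 ⟨Finset.mem_univ q, huq⟩))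
  have hdet : ((slidingMatrix H j).submatrix id t).det ≠ 0 := by
    refine h t fun s i hs hsj hi => ?_
    have hsub : (Finset.univ.filter fun q => u q ≠ 0 ∧ (q : ℕ) < s * n) ⊆
        T.filter fun q : Fin _ => (q : ℕ) < s * n := by
      rw [← Finset.filter_filter]
      exact Finset.filter_subset_filter _ hsupp
    have hanti : Antitone fun q : Fin ((j + 1) * n) => (q : ℕ) < s * n :=
      fun _ _ hqq' hq' => lt_of_le_of_lt hqq' hq'
    have hcard := (hcount s hs hsj).trans (Finset.card_le_card hsub)
    exact apply_orderEmbOfFin_of_lt_card_filter hanti hT (by omega)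
  have hzero : u ∘ t = 0 := eq_zero_of_mulVec_eq_zero hdet
    (by rw [submatrix_mulVec_comp t.injective _ hut, hHu])
  refine hu (funext fun q => ?_)
  by_cases hq : q ∈ Set.range t
  · obtain ⟨i, rfl⟩ := hq
    exact congrFun hzero i
  · exact hut q hq

/-- The coefficient vectors `v_0, …, v_{N-1}` of `v`, stacked in the column order of
`slidingMatrix`. -/
def coeffVec (v : Fin n → F[X]) (N : ℕ) : Fin (N * n) → F :=
  fun q => (v q.modNat).coeff q.divNat

theorem slidingMatrix_mulVec_coeffVec (H : Matrix (Fin m) (Fin n) F[X]) (v : Fin n → F[X])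
    (j : ℕ) : slidingMatrix H j *ᵥ coeffVec v (j + 1) = coeffVec (H *ᵥ v) (j + 1) := by
  ext p
  rw [coeffVec, coeff_mulVec_eq_sum (N := j + 1) fun b l hl hlp => absurd p.divNat.2 (by omega),
    mulVec, dotProduct, ← finProdFinEquiv.sum_comp]
  refine Finset.sum_congr rfl fun q _ => ?_
  simp only [slidingMatrix, of_apply, coeffVec, divNat_finProdFinEquiv, modNat_finProdFinEquiv,
    Fin.le_def]

open Classical in
theorem card_coeffVec_ne_zero_lt (v : Fin n → F[X]) {i N : ℕ} (hi : i < N) :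
    (Finset.univ.filter fun q => coeffVec v N q ≠ 0 ∧ (q : ℕ) < (i + 1) * n).card =
      truncWeight v i := by
  simp only [← divNat_lt_iff, truncWeight, hammingNorm, Finset.card_filter]
  rw [← finProdFinEquiv.sum_comp, Fintype.sum_prod_type]
  simp only [coeffVec, divNat_finProdFinEquiv, modNat_finProdFinEquiv]
  rw [Fin.sum_univ_eq_sum_range
    (fun l => ∑ b, if (v b).coeff l ≠ 0 ∧ l < i + 1 then 1 else 0) N]
  refine (Finset.sum_subset_zero_on_sdiff (Finset.range_mono hi) (fun l hl => ?_)
    fun l hl => ?_).symm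
  · have hil : ¬l < i + 1 := by simpa using (Finset.mem_sdiff.1 hl).2
    simp [hil]
  · simp [Finset.mem_range.1 hl]

open Classical in
theorem hammingNorm_coeffVec (v : Fin n → F[X]) (j : ℕ) :
    hammingNorm (coeffVec v (j + 1)) = truncWeight v j := by
  rw [← card_coeffVec_ne_zero_lt v (Nat.lt_succ_self j), hammingNorm]
  congr 1
  ext q
  simp

theorem MDPMinorCriterion.lt_truncWeight {j L : ℕ} (h : MDPMinorCriterion H L) (hmn : m ≤ n)
    {v : Fin n → F[X]} (hv : H *ᵥ v = 0) (hv0 : (fun b => (v b).coeff 0) ≠ 0) (hj : j ≤ L) :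
    (j + 1) * m < truncWeight v j := by
  induction j using Nat.strong_induction_on with
  | _ j ih =>
    rw [← hammingNorm_coeffVec]
    refine (h.mono hmn hj).lt_hammingNorm ?_ ?_ ?_ hmn
    · obtain ⟨b, hb⟩ := Function.ne_iff.1 hv0
      refine Function.ne_iff.2 ⟨finProdFinEquiv (0, b), ?_⟩
      simpa [coeffVec, divNat_finProdFinEquiv, modNat_finProdFinEquiv] using hb
    · rw [slidingMatrix_mulVec_coeffVec, hv]
      ext
      simp [coeffVec]
    · intro s hs hsj
      obtain ⟨i, rfl⟩ := Nat.exists_eq_add_of_le' hs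
      rw [card_coeffVec_ne_zero_lt v (by omega)]
      exact (ih i hsj (by omega)).le

end SlidingMatrix

section ColumnDistance

theorem exists_mulVec_eq_add_smul {R ι : Type*} [CommRing R] [Fintype ι] [DecidableEq ι]
    {M : Matrix ι ι R} {p : R} (h : IsCoprime M.det p) (y : ι → R) :
    ∃ x z, M *ᵥ x = y + p • z := by
  obtain ⟨a, b, hab⟩ := h
  refine ⟨a • M.adjugate *ᵥ y, -b • y, ?_⟩
  calc M *ᵥ (a • M.adjugate *ᵥ y)
      = (a * M.det) • y := by
        rw [mulVec_smul, mulVec_mulVec, mul_adjugate, smul_mulVec, one_mulVec, smul_smul]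
    _ = (1 - b * p) • y := by rw [← hab, add_sub_cancel_right]
    _ = y + p • (-b • y) := by module

variable {F : Type*} [Field F] {m n : ℕ} {H : Matrix (Fin m) (Fin n) F[X]}

theorem hammingNorm_le_card {β : Type*} [Zero β] [DecidableEq β] {ι : Type*} [Fintype ι]
    {x : ι → β} {s : Finset ι} (hx : ∀ b ∉ s, x b = 0) : hammingNorm x ≤ s.card :=
  Finset.card_le_card fun b hb => by_contra fun hbs => (Finset.mem_filter.1 hb).2 (hx b hbs)

theorem truncWeight_le {v : Fin n → F[X]} {s : Finset (Fin n)} {c : Fin n} {j : ℕ}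
    (h0 : ∀ b ∉ insert c s, (v b).coeff 0 = 0)
    (hpos : ∀ i, 0 < i → i ≤ j → ∀ b ∉ s, (v b).coeff i = 0) :
    truncWeight v j ≤ s.card * (j + 1) + 1 := by
  classical
  have h0_le : (hammingNorm fun b => (v b).coeff 0) ≤ s.card + 1 :=
    (hammingNorm_le_card h0).trans (Finset.card_insert_le c s)
  have hpos_le : ∑ i ∈ Finset.range j, (hammingNorm fun b => (v b).coeff (i + 1)) ≤
      j * s.card := by
    refine (Finset.sum_le_card_nsmul _ _ s.card fun i hi => ?_).trans_eq (by simp)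
    exact hammingNorm_le_card (hpos (i + 1) i.succ_pos (Finset.mem_range.1 hi))
  calc truncWeight v j
      = ∑ i ∈ Finset.range j, (hammingNorm fun b => (v b).coeff (i + 1)) +
          hammingNorm fun b => (v b).coeff 0 := by
        rw [truncWeight, Finset.sum_range_succ']
    _ ≤ j * s.card + (s.card + 1) := add_le_add hpos_le h0_le
    _ = s.card * (j + 1) + 1 := by ring

theorem exists_mulVec_eq_zero_coeff_eq (hH : Function.Surjective H.mulVec) {w : Fin n → F[X]}
    {z : Fin m → F[X]} {j : ℕ} (hw : H *ᵥ w = (X ^ (j + 1) : F[X]) • z) :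
    ∃ v, H *ᵥ v = 0 ∧ ∀ b, ∀ i ≤ j, (v b).coeff i = (w b).coeff i := by
  obtain ⟨x, hx⟩ := hH z
  refine ⟨w - (X ^ (j + 1) : F[X]) • x, ?_, fun b i hi => ?_⟩
  · rw [mulVec_sub, mulVec_smul, hw, hx, sub_self]
  · simp [coeff_X_pow_mul', hi]

theorem exists_mulVec_eq_zero_truncWeight_le (hH : Function.Surjective H.mulVec)
    {t : Fin m ↪ Fin n} (ht : (H.submatrix id t).det.coeff 0 ≠ 0) {c : Fin n}
    (hc : c ∉ Set.range t) (j : ℕ) :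
    ∃ v, H *ᵥ v = 0 ∧ (v c).coeff 0 ≠ 0 ∧ truncWeight v j ≤ m * (j + 1) + 1 := by
  have hcop : IsCoprime (H.submatrix id t).det (X ^ (j + 1)) :=
    (irreducible_X.coprime_iff_not_dvd.2 (mt X_dvd_iff.1 ht)).symm.pow_right
  obtain ⟨x, z, hx⟩ := exists_mulVec_eq_add_smul hcop (-H.col c)
  let x' : Fin n → F[X] := Function.extend t x 0
  have hx'_apply (b : Fin n) (hb : b ∉ Set.range t) : x' b = 0 := Function.extend_apply' _ _ b hb
  have hx' : H *ᵥ x' = H.submatrix id t *ᵥ x := by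
    rw [← submatrix_mulVec_comp t.injective H hx'_apply, Function.extend_comp t.injective]
  let w : Fin n → F[X] := x' + Pi.single c 1
  have hw : H *ᵥ w = (X ^ (j + 1) : F[X]) • z := by
    rw [mulVec_add, hx', hx, mulVec_single_one]
    exact neg_add_cancel_comm _ _
  have hw_apply {b : Fin n} (hb : b ∉ Set.range t) : w b = (Pi.single c 1 : Fin n → F[X]) b :=
    (congrArg (· + _) (hx'_apply b hb)).trans (zero_add _)
  obtain ⟨v, hv, hvw⟩ := exists_mulVec_eq_zero_coeff_eq hH hw
  refine ⟨v, hv, ?_, ?_⟩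
  · simp [hvw c 0 j.zero_le, hw_apply hc]
  · rw [← Fintype.card_fin m, ← Finset.card_univ, ← Finset.card_map t]
    refine truncWeight_le (c := c) (fun b hb => ?_) fun i hi hij b hb => ?_
    · obtain ⟨hbc, hbt⟩ : b ≠ c ∧ b ∉ Set.range t := by simpa using hb
      simp [hvw b 0 j.zero_le, hw_apply hbt, hbc]
    · rw [hvw b i hij, hw_apply (by simpa using hb), Pi.single_apply]
      split_ifs <;> simp [coeff_one, hi.ne']

theorem columnDistance_ker_mulVecLin (hH : Function.Surjective H.mulVec) (hmn : m < n) {L : ℕ}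
    (h : MDPMinorCriterion H L) {j : ℕ} (hj : j ≤ L) :
    columnDistance (LinearMap.ker H.mulVecLin) j = m * (j + 1) + 1 := by
  refine IsLeast.csInf_eq ⟨?_, ?_⟩
  · let t := Fin.castLEOrderEmb hmn.le
    have hc : (⟨m, hmn⟩ : Fin n) ∉ Set.range t := by
      rintro ⟨i, hi⟩
      exact i.2.ne (congrArg Fin.val hi)
    obtain ⟨v, hv, hvc, hle⟩ := exists_mulVec_eq_zero_truncWeight_le hH
      ((h.mono hmn.le (Nat.zero_le L)).det_coeff_zero_ne_zero t) (c := ⟨m, hmn⟩) hc j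
    have hv0 : (fun b => (v b).coeff 0) ≠ 0 := Function.ne_iff.2 ⟨_, hvc⟩
    have hlt := h.lt_truncWeight hmn.le hv hv0 hj
    exact ⟨v, hv, hv0, hle.antisymm (by rwa [mul_comm m])⟩
  · rintro _ ⟨v, hv, hv0, rfl⟩
    rw [mul_comm]
    exact h.lt_truncWeight hmn.le hv hv0 hj

end ColumnDistance

end ConvCode

open ConvCode in
theorem mainTheorem5_general {F : Type*} [Field F] {n k δ r : ℕ} (hk : 0 < k) (hkn : k < n)
    {H : Matrix (Fin (n - k)) (Fin n) (Polynomial F)} (hsum : ∑ a, rowDegree H a = δ)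
    (hminors : MDPMinorCriterion H (δ / k + δ / (n - k))) {S : Finset (Fin (n - k))}
    (hS : S.card = δ % (n - k))
    (hbar : LinearIndependent F (barMatrix H (δ / (n - k) + 1) r S).row) :
    IsLeftPrime H ∧ IsMDP n k δ (LinearMap.ker H.mulVecLin) := by
  have hrow := rowDegree_eq_add_ite hbar (by rw [hsum, hS, Nat.div_add_mod])
  have hH := mulVec_surjective_of_linearIndependent_barMatrix hbar fun a => (hrow a).le
  have hlead := leadingRowCoeff_mulVec_surjective hbar fun a => (hrow a).le
  have hdegree : maxMinorDegree H = δ := (maxMinorDegree_eq_sum_rowDegree hlead).trans hsum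
  have hcode := isConvolutionalCode_ker_mulVecLin hH (Nat.sub_add_cancel hkn.le)
  rw [hdegree] at hcode
  exact ⟨isLeftPrime_of_mulVec_surjective hH, hcode, fun j hj =>
    columnDistance_ker_mulVecLin hH (Nat.sub_lt (hk.trans hkn) hk) hminors hj⟩

theorem mainTheorem5 {F : Type*} [Field F] [Finite F] (n k δ ν : ℕ)
    (hk : 0 < k) (hkn : k < n) (hδ : ¬ (n - k) ∣ δ) (hν : ν = δ / (n - k) + 1)
    (H : Matrix (Fin (n - k)) (Fin n) (Polynomial F))
    (hdeg : ∀ a b, (H a b).natDegree ≤ ν)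
    (hred : ConvCode.IsRowReduced H)
    (hsum : ∑ a, ConvCode.rowDegree H a = δ)
    (hminors : ConvCode.MDPMinorCriterion H (δ / k + ν - 1))
    (hbar : ∃ (r : ℕ) (S : Finset (Fin (n - k))), S.card = δ - (n - k) * (δ / (n - k)) ∧
      LinearIndependent F (ConvCode.barMatrix H ν r S).row) :
    ConvCode.IsLeftPrime H ∧
      ∃ C : Submodule (Polynomial F) (Fin n → Polynomial F),
        ConvCode.IsMDP n k δ C ∧ ConvCode.IsParityCheckMatrix H C := by
  subst hν
  obtain ⟨r, S, hS, hbar⟩ := hbar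
  have hcard : S.card = δ % (n - k) := hS.trans Nat.mod_eq_sub_mul_div.symm
  exact (mainTheorem5_general hk hkn hsum hminors hcard hbar).imp_right fun hMDP =>
    ⟨_, hMDP, fun _ => Iff.rfl⟩
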